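/- **Proposition 3.1.** Let $A$ be a graded $C^*$-algebra with grading automorphism $\alpha$ (a $*$-automorphism with $\alpha^2=\mathrm{id}$; $A_n=\{a:\alpha(a)=(-1)^na\}$), let $C_0(\mathbb R)$ be graded by even and odd functions, and let $\phi : C_0(\mathbb R)\to A$ be a graded $*$-homomorphism. Regard $A$ as a right Hilbert $A$-module with $\langle x,y\rangle=x^*y$. Let $A_\phi=\overline{\phi(C_0(\mathbb R))A}$, the closed linear span of the products $\phi(f)a$ ($f\in C_0(\mathbb R)$, $a\in A$); it is a closed right ideal, i.e. a closed Hilbert $A$-submodule of $A$. Then: 1. $A_\phi$ is graded, i.e. $A_\phi=(A_\phi\cap A_0)\oplus(A_\phi\cap A_1)$, and $\phi$-invariant, i.e. $\phi(f)A_\phi\subseteq A_\phi$ for all $f\in C_0(\mathbb R)$. 2. There is a self-adjoint regular operator $D$ on $A_\phi$ of degree one with $\phi(f)|_{A_\phi}=f(D)$ for all $f\in C_0(\mathbb R)$. Moreover $D$ is the closure of the operator $\phi(f)a\mapsto\phi(d\cdot f)a$, where $d(t)=t$, defined on the linear span of the $\phi(f)a$ with $f\in C_c(\mathbb R)$ and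 $a\in A$: the graph of $D$ is the closure in $A\times A$ of the linear span of the pairs $(\phi(f)a,\phi(d\cdot f)a)$. 3. $A_\phi$ is maximal: if $E\subseteq A$ is any $\phi$-invariant closed graded Hilbert $A$-submodule that carries a self-adjoint regular operator $D'$ of degree one with $\phi(f)|_E=f(D')$ for all $f\in C_0(\mathbb R)$, then $E\subseteq A_\phi$. Here a regular operator on a Hilbert $A$-module $E$ is a densely defined closed $A$-linear map $D:\operatorname{Dom}(D)\to E$ such that $D^*$ is densely defined and $1+D^*D$ has dense range. It is self-adjoint if $D^*=D$. It has degree one if $\operatorname{Dom}(D)$ is graded and $D$ maps homogeneous elements of degree $n$ to homogeneous elements of degree $n+1 \pmod 2$. For self-adjoint regular $D$ and $f\in C_0(\mathbb R)$, $f(D)$ is the element of the $C^*$-algebra $\mathcal L(E)$ of adjointable operators given by the functional calculus: $f(D)=g((D+i)^{-1})$, where $g((t+i)^{-1})=f(t)$ for $t\in\mathbb R$ and $g(0)=0$. -/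

import Mathlib

open scoped ZeroAtInfty

/-! ### Graded C*-algebras and graded homomorphisms

A grading on a C*-algebra `A` is a *-automorphism `α` with `α ∘ α = id`; degrees are natural
numbers read modulo 2, through the sign `(-1) ^ n`. -/

/-- `x` is homogeneous of degree `n` (mod 2) for the grading automorphism `α`. -/
def HasDegree {A : Type*} [NonUnitalCStarAlgebra A] (α : A ≃⋆ₐ[ℂ] A) (n : ℕ) (x : A) : Prop :=
  α x = (-1 : ℂ) ^ n • x

/-- The even-odd grading of `C₀(ℝ)`: degree `0` (mod 2) is even, degree `1` (mod 2) is odd. -/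
def HasParity (n : ℕ) (f : C₀(ℝ, ℂ)) : Prop :=
  ∀ t : ℝ, f (-t) = (-1 : ℂ) ^ n * f t

/-- A *-homomorphism `C₀(ℝ) → A` is graded if it preserves degrees. -/
def IsGradedHom {A : Type*} [NonUnitalCStarAlgebra A] (α : A ≃⋆ₐ[ℂ] A)
    (φ : C₀(ℝ, ℂ) →⋆ₙₐ[ℂ] A) : Prop :=
  ∀ (n : ℕ) (f : C₀(ℝ, ℂ)), HasParity n f → HasDegree α n (φ f)

/-! ### Closed Hilbert submodules of `A` -/

/-- A closed Hilbert `A`-submodule of the right Hilbert `A`-module `A`, whose inner product is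
`⟨x, y⟩ = x* y`, i.e. a closed right ideal. The Hilbert module norm `‖⟨x, x⟩‖ ^ (1 / 2)` is the
norm of `A`. -/
structure HilbertSubmodule (A : Type*) [NonUnitalCStarAlgebra A] extends Submodule ℂ A where
  mul_mem' : ∀ x ∈ carrier, ∀ a : A, x * a ∈ carrier
  isClosed' : IsClosed carrier

namespace HilbertSubmodule

variable {A : Type*} [NonUnitalCStarAlgebra A]

/-- The underlying type of a Hilbert submodule. -/
def Elem (E : HilbertSubmodule A) : Type _ := E.toSubmodule

/-- The norm on a Hilbert submodule is the norm of `A`. -/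
noncomputable instance (E : HilbertSubmodule A) : NormedAddCommGroup E.Elem :=
  inferInstanceAs (NormedAddCommGroup E.toSubmodule)

noncomputable instance (E : HilbertSubmodule A) : NormedSpace ℂ E.Elem :=
  inferInstanceAs (NormedSpace ℂ E.toSubmodule)

instance (E : HilbertSubmodule A) : CompleteSpace E.Elem :=
  E.isClosed'.completeSpace_coe

/-- The inclusion `E → A`. -/
noncomputable def incl (E : HilbertSubmodule A) : E.Elem →ₗᵢ[ℂ] A := E.toSubmodule.subtypeₗᵢ

theorem incl_mem (E : HilbertSubmodule A) (x : E.Elem) : E.incl x ∈ E.toSubmodule :=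
  Subtype.property (p := fun a => a ∈ E.toSubmodule) x

/-- The `A`-valued inner product `⟨x, y⟩ = x* y`. -/
noncomputable def ip (E : HilbertSubmodule A) (x y : E.Elem) : A := star (E.incl x) * E.incl y

/-- The right action of `A`. -/
noncomputable def rmul (E : HilbertSubmodule A) (x : E.Elem) (a : A) : E.Elem :=
  (⟨E.incl x * a, E.mul_mem' _ (E.incl_mem x) a⟩ : E.toSubmodule)

/-- `E` is graded: `E = (E ∩ A₀) ⊕ (E ∩ A₁)`. -/
def IsGraded (E : HilbertSubmodule A) (α : A ≃⋆ₐ[ℂ] A) : Prop :=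
  ∀ x : E.Elem, ∃ x₀ x₁ : E.Elem,
    HasDegree α 0 (E.incl x₀) ∧ HasDegree α 1 (E.incl x₁) ∧ x = x₀ + x₁

/-- `E` is `φ`-invariant: left multiplication by each `φ f` maps `E` to itself. -/
def IsInvariant (E : HilbertSubmodule A) (φ : C₀(ℝ, ℂ) →⋆ₙₐ[ℂ] A) : Prop :=
  ∀ (f : C₀(ℝ, ℂ)) (x : E.Elem), φ f * E.incl x ∈ E.toSubmodule

theorem ip_self_norm (E : HilbertSubmodule A) (x : E.Elem) : ‖E.ip x x‖ = ‖x‖ * ‖x‖ := by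
  rw [ip, CStarRing.norm_star_mul_self, LinearIsometry.norm_map]

theorem ip_norm_le (E : HilbertSubmodule A) (x y : E.Elem) : ‖E.ip x y‖ ≤ ‖x‖ * ‖y‖ :=
  (norm_mul_le _ _).trans_eq (by simp)

theorem ip_sub_right (E : HilbertSubmodule A) (x y z : E.Elem) :
    E.ip x (y - z) = E.ip x y - E.ip x z := by
  simp [ip, mul_sub]

theorem star_ip (E : HilbertSubmodule A) (x y : E.Elem) : star (E.ip x y) = E.ip y x := by
  simp [ip]

theorem ext_ip (E : HilbertSubmodule A) {y z : E.Elem} (h : ∀ x, E.ip x y = E.ip x z) :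
    y = z := by
  have h1 : ‖E.ip (y - z) (y - z)‖ = 0 := by
    rw [ip_sub_right, h, sub_self, norm_zero]
  rw [ip_self_norm, mul_self_eq_zero, norm_eq_zero, sub_eq_zero] at h1
  exact h1

/-! ### The C*-algebra `L(E)` of adjointable operators -/

/-- `S` is an adjoint of `T`: `⟨T x, y⟩ = ⟨x, S y⟩`. -/
def IsAdj (E : HilbertSubmodule A) (T S : E.Elem →L[ℂ] E.Elem) : Prop :=
  ∀ x y : E.Elem, E.ip (T x) y = E.ip x (S y)

theorem IsAdj.symm {E : HilbertSubmodule A} {T S : E.Elem →L[ℂ] E.Elem} (h : E.IsAdj T S) :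
    E.IsAdj S T := fun x y => by
  rw [← star_ip, ← h y x, star_ip]

theorem IsAdj.unique {E : HilbertSubmodule A} {T S S' : E.Elem →L[ℂ] E.Elem}
    (h : E.IsAdj T S) (h' : E.IsAdj T S') : S = S' := by
  ext1 y
  exact E.ext_ip fun x => by rw [← h, ← h']

theorem IsAdj.add {E : HilbertSubmodule A} {T S T' S' : E.Elem →L[ℂ] E.Elem}
    (h : E.IsAdj T S) (h' : E.IsAdj T' S') : E.IsAdj (T + T') (S + S') := fun x y => by
  have h1 := h x y
  have h2 := h' x y
  simp only [ip] at h1 h2 ⊢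
  simp [add_mul, mul_add, h1, h2]

theorem IsAdj.smul {E : HilbertSubmodule A} {T S : E.Elem →L[ℂ] E.Elem}
    (h : E.IsAdj T S) (c : ℂ) : E.IsAdj (c • T) (star c • S) := fun x y => by
  have h1 := h x y
  simp only [ip] at h1 ⊢
  simp [smul_mul_assoc, mul_smul_comm, h1]

theorem IsAdj.mul {E : HilbertSubmodule A} {T S T' S' : E.Elem →L[ℂ] E.Elem}
    (h : E.IsAdj T S) (h' : E.IsAdj T' S') : E.IsAdj (T * T') (S' * S) := fun x y => by
  change E.ip (T (T' x)) y = E.ip x (S' (S y))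
  rw [h, h']

theorem IsAdj.one (E : HilbertSubmodule A) : E.IsAdj 1 1 := fun _ _ => rfl

theorem IsAdj.norm_sq_le {E : HilbertSubmodule A} {T S : E.Elem →L[ℂ] E.Elem}
    (h : E.IsAdj T S) : ‖T‖ * ‖T‖ ≤ ‖S * T‖ := by
  have h1 : ‖T‖ ≤ Real.sqrt ‖S * T‖ := by
    refine ContinuousLinearMap.opNorm_le_bound _ (Real.sqrt_nonneg _) fun x => ?_
    conv_rhs => rw [← Real.sqrt_mul_self (norm_nonneg x), ← Real.sqrt_mul (norm_nonneg _)]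
    apply Real.le_sqrt_of_sq_le
    rw [sq, ← ip_self_norm, h]
    calc ‖E.ip x (S (T x))‖ ≤ ‖x‖ * ‖(S * T) x‖ := E.ip_norm_le _ _
      _ ≤ ‖x‖ * (‖S * T‖ * ‖x‖) := by gcongr; exact (S * T).le_opNorm x
      _ = ‖S * T‖ * (‖x‖ * ‖x‖) := by ring
  calc ‖T‖ * ‖T‖ ≤ Real.sqrt ‖S * T‖ * Real.sqrt ‖S * T‖ := by gcongr
    _ = ‖S * T‖ := Real.mul_self_sqrt (norm_nonneg _)

theorem IsAdj.norm_le {E : HilbertSubmodule A} {T S : E.Elem →L[ℂ] E.Elem}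
    (h : E.IsAdj T S) : ‖T‖ ≤ ‖S‖ := by
  rcases (norm_nonneg T).eq_or_lt with h0 | h0
  · rw [← h0]; exact norm_nonneg S
  · exact le_of_mul_le_mul_right (h.norm_sq_le.trans (norm_mul_le S T)) h0

theorem IsAdj.norm_eq {E : HilbertSubmodule A} {T S : E.Elem →L[ℂ] E.Elem}
    (h : E.IsAdj T S) : ‖S‖ = ‖T‖ := le_antisymm h.symm.norm_le h.norm_le

/-- The algebra of bounded operators on `E` that have an adjoint (such operators are
automatically `A`-linear). -/
def adjointable (E : HilbertSubmodule A) : Subalgebra ℂ (E.Elem →L[ℂ] E.Elem) where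
  carrier := {T | ∃ S, E.IsAdj T S}
  mul_mem' := by
    rintro T T' ⟨S, h⟩ ⟨S', h'⟩
    exact ⟨_, h.mul h'⟩
  add_mem' := by
    rintro T T' ⟨S, h⟩ ⟨S', h'⟩
    exact ⟨_, h.add h'⟩
  algebraMap_mem' c := by
    rw [Algebra.algebraMap_eq_smul_one]
    exact ⟨_, (IsAdj.one E).smul c⟩

/-- The C*-algebra `L(E)` of adjointable operators, with the operator norm. -/
abbrev L (E : HilbertSubmodule A) : Type _ := E.adjointable

/-- The involution `T ↦ T*` of `L(E)`. -/
noncomputable instance (E : HilbertSubmodule A) : Star E.L where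
  star T := ⟨T.2.choose, (T : E.Elem →L[ℂ] E.Elem), T.2.choose_spec.symm⟩

theorem isAdj_star (E : HilbertSubmodule A) (T : E.L) :
    E.IsAdj (T : E.Elem →L[ℂ] E.Elem) ((star T : E.L) : E.Elem →L[ℂ] E.Elem) :=
  T.2.choose_spec

theorem star_eq (E : HilbertSubmodule A) {T S : E.L}
    (h : E.IsAdj (T : E.Elem →L[ℂ] E.Elem) (S : E.Elem →L[ℂ] E.Elem)) : star T = S :=
  Subtype.ext ((E.isAdj_star T).unique h)

noncomputable instance (E : HilbertSubmodule A) : StarRing E.L where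
  star_involutive T := E.star_eq (E.isAdj_star T).symm
  star_mul T S := E.star_eq ((E.isAdj_star T).mul (E.isAdj_star S))
  star_add T S := E.star_eq ((E.isAdj_star T).add (E.isAdj_star S))

instance (E : HilbertSubmodule A) : StarModule ℂ E.L where
  star_smul c T := E.star_eq ((E.isAdj_star T).smul c)

instance (E : HilbertSubmodule A) : CStarRing E.L where
  norm_mul_self_le T := (E.isAdj_star T).norm_sq_le

theorem isClosed_adjointable (E : HilbertSubmodule A) :
    IsClosed (E.adjointable : Set (E.Elem →L[ℂ] E.Elem)) := by
  refine isClosed_of_closure_subset fun T hT => ?_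
  obtain ⟨u, hu, hlim⟩ := mem_closure_iff_seq_limit.1 hT
  choose S hS using hu
  have hsub : ∀ m n, E.IsAdj (u m - u n) (S m - S n) := fun m n => by
    have := (hS m).add ((hS n).smul (-1))
    simpa [sub_eq_add_neg, neg_one_smul ℂ] using this
  have hc : CauchySeq S := by
    have hcu := hlim.cauchySeq
    rw [Metric.cauchySeq_iff] at hcu ⊢
    intro ε hε
    obtain ⟨N, hN⟩ := hcu ε hε
    refine ⟨N, fun m hm n hn => ?_⟩
    rw [dist_eq_norm, (hsub m n).norm_eq, ← dist_eq_norm]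
    exact hN m hm n hn
  obtain ⟨S', hS'⟩ := cauchySeq_tendsto_of_complete hc
  refine ⟨S', fun x y => ?_⟩
  have h1 : Filter.Tendsto (fun n => E.ip (u n x) y) Filter.atTop (nhds (E.ip (T x) y)) := by
    have : Filter.Tendsto (fun n => u n x) Filter.atTop (nhds (T x)) :=
      ((ContinuousLinearMap.apply ℂ E.Elem x).continuous.tendsto T).comp hlim
    have h2 := (E.incl.continuous.tendsto (T x)).comp this
    exact (h2.star).mul_const _
  have h2 : Filter.Tendsto (fun n => E.ip x (S n y)) Filter.atTop (nhds (E.ip x (S' y))) := by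
    have : Filter.Tendsto (fun n => S n y) Filter.atTop (nhds (S' y)) :=
      ((ContinuousLinearMap.apply ℂ E.Elem y).continuous.tendsto S').comp hS'
    have h2 := (E.incl.continuous.tendsto (S' y)).comp this
    exact h2.const_mul _
  simp only [fun n => hS n x y] at h1
  exact tendsto_nhds_unique h1 h2

instance (E : HilbertSubmodule A) : CompleteSpace E.L :=
  E.isClosed_adjointable.completeSpace_coe

noncomputable instance (E : HilbertSubmodule A) : CStarAlgebra E.L where

/-! ### Unbounded regular operators and their functional calculus -/

/-- The graph of the adjoint of `D`: the pairs `(y, z)` with `⟨D x, y⟩ = ⟨x, z⟩` for all `x` in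
the domain of `D`. -/
def adjointGraph (E : HilbertSubmodule A) (D : E.Elem →ₗ.[ℂ] E.Elem) :
    Submodule ℂ (E.Elem × E.Elem) where
  carrier := {p | ∀ x : D.domain, E.ip (D x) p.1 = E.ip (x : E.Elem) p.2}
  add_mem' := by
    intro p q hp hq x
    have h1 := hp x
    have h2 := hq x
    simp only [ip] at h1 h2 ⊢
    simp [mul_add, h1, h2]
  zero_mem' := by
    intro x
    simp [ip]
  smul_mem' := by
    intro c p hp x
    have h1 := hp x
    simp only [ip] at h1 ⊢
    simp [mul_smul_comm, h1]

/-- The adjoint `D*` of a densely defined operator `D`. -/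
noncomputable def adj (E : HilbertSubmodule A) (D : E.Elem →ₗ.[ℂ] E.Elem) :
    E.Elem →ₗ.[ℂ] E.Elem :=
  (E.adjointGraph D).toLinearPMap

/-- A regular operator on `E`: a densely defined closed `A`-linear operator `D` such that `D*` is
densely defined and `1 + D* D` has dense range. -/
structure IsRegular (E : HilbertSubmodule A) (D : E.Elem →ₗ.[ℂ] E.Elem) : Prop where
  dense_domain : Dense (D.domain : Set E.Elem)
  closed : D.IsClosed
  rmul_mem : ∀ (x : D.domain) (a : A), E.rmul x a ∈ D.domain
  map_rmul : ∀ (x : D.domain) (a : A), D ⟨E.rmul x a, rmul_mem x a⟩ = E.rmul (D x) a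
  dense_adj_domain : Dense ((E.adj D).domain : Set E.Elem)
  dense_range : Dense {w : E.Elem | ∃ (x : D.domain) (h : D x ∈ (E.adj D).domain),
    w = x + E.adj D ⟨D x, h⟩}

/-- `D` has degree one: its domain is a graded subspace, and `D` maps homogeneous elements of
degree `n` to homogeneous elements of degree `n + 1` (mod 2). -/
def IsDegreeOne (E : HilbertSubmodule A) (α : A ≃⋆ₐ[ℂ] A) (D : E.Elem →ₗ.[ℂ] E.Elem) : Prop :=
  (∀ x : D.domain, ∃ x₀ x₁ : D.domain,
    HasDegree α 0 (E.incl x₀) ∧ HasDegree α 1 (E.incl x₁) ∧ x = x₀ + x₁) ∧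
  ∀ (n : ℕ) (x : D.domain), HasDegree α n (E.incl x) → HasDegree α (n + 1) (E.incl (D x))

/-- `R = (D + i)⁻¹`: `R` is a two-sided inverse of `D + i : Domain(D) → E`. -/
def IsResolvent (E : HilbertSubmodule A) (D : E.Elem →ₗ.[ℂ] E.Elem) (R : E.L) : Prop :=
  (∀ x : E.Elem, ∃ h : R.1 x ∈ D.domain, D ⟨R.1 x, h⟩ + Complex.I • R.1 x = x) ∧
  ∀ y : D.domain, R.1 (D y + Complex.I • (y : E.Elem)) = y

open Classical in
/-- The resolvent `(D + i)⁻¹` in `L(E)`. For self-adjoint regular `D` it exists and is a normal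
element (the default value `0` is only for other operators). -/
noncomputable def resolvent (E : HilbertSubmodule A) (D : E.Elem →ₗ.[ℂ] E.Elem) : E.L :=
  if h : ∃ R : E.L, E.IsResolvent D R then h.choose else 0

open Classical in
/-- The functional calculus `f(D)` in `L(E)` of a self-adjoint regular operator `D`, for
`f ∈ C₀(ℝ)`. It is the continuous functional calculus `g((D + i)⁻¹)` of the normal element
`(D + i)⁻¹` of the C*-algebra `L(E)`, for the function `g` with `g((t + i)⁻¹) = f(t)` for real
`t` and `g(0) = 0`, which is continuous on the set `{(t + i)⁻¹ | t ∈ ℝ} ∪ {0}` that contains the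
spectrum. -/
noncomputable def funCalc (E : HilbertSubmodule A) (D : E.Elem →ₗ.[ℂ] E.Elem)
    (f : C₀(ℝ, ℂ)) : E.L :=
  cfcₙ (fun z : ℂ => if z = 0 then 0 else f (z⁻¹ - Complex.I).re) (E.resolvent D)

/-- `D` is a self-adjoint regular operator of degree one on `E` such that the restriction of
`φ f` to `E` is `f(D)` for all `f ∈ C₀(ℝ)`. -/
structure Generates (E : HilbertSubmodule A) (α : A ≃⋆ₐ[ℂ] A) (φ : C₀(ℝ, ℂ) →⋆ₙₐ[ℂ] A)
    (D : E.Elem →ₗ.[ℂ] E.Elem) : Prop where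
  regular : E.IsRegular D
  selfAdjoint : E.adj D = D
  degreeOne : E.IsDegreeOne α D
  funCalc_eq : ∀ (f : C₀(ℝ, ℂ)) (x : E.Elem), φ f * E.incl x = E.incl ((E.funCalc D f).1 x)

/-- The closed right ideal `A_φ`, the closure of (the linear span of) `φ(C₀(ℝ)) A`. -/
def ofHom (φ : C₀(ℝ, ℂ) →⋆ₙₐ[ℂ] A) : HilbertSubmodule A where
  toSubmodule :=
    (Submodule.span ℂ {x : A | ∃ (f : C₀(ℝ, ℂ)) (a : A), x = φ f * a}).topologicalClosure
  isClosed' := Submodule.isClosed_topologicalClosure _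
  mul_mem' := by
    intro x hx a
    refine map_mem_closure (f := fun y : A => y * a) (by fun_prop) hx ?_
    intro y hy
    induction hy using Submodule.span_induction with
    | mem y hy =>
      obtain ⟨f, b, rfl⟩ := hy
      exact Submodule.subset_span ⟨f, b * a, mul_assoc _ _ _⟩
    | zero =>
      change (0 : A) * a ∈ Submodule.span ℂ _
      rw [zero_mul]
      exact zero_mem _
    | add y z _ _ hy hz =>
      change (y + z) * a ∈ Submodule.span ℂ _
      rw [add_mul]
      exact add_mem hy hz
    | smul c y _ hy =>
      change (c • y) * a ∈ Submodule.span ℂ _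
      rw [smul_mul_assoc]
      exact Submodule.smul_mem _ c hy

end HilbertSubmodule

/-- The graph of the operator with domain `φ(C_c(ℝ)) A` given by `φ(f) a ↦ φ(d f) a`, where
`d(t) = t`: the linear span of the pairs `(φ(f) a, φ(d f) a)` with `f` compactly supported. -/
def coreGraph {A : Type*} [NonUnitalCStarAlgebra A] (φ : C₀(ℝ, ℂ) →⋆ₙₐ[ℂ] A) :
    Submodule ℂ (A × A) :=
  Submodule.span ℂ {p | ∃ (f df : C₀(ℝ, ℂ)) (a : A), HasCompactSupport f ∧
    (∀ t : ℝ, df t = t * f t) ∧ p = (φ f * a, φ df * a)}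

/-! ### Functions of the resolvent variable -/

/-! Everything is reduced to the bounded operator `R = (D + i)⁻¹`. The function `r(t) = (t + i)⁻¹`
generates `C₀(ℝ)`: each `f` is `g(r)`, where `g` is `f` transported to the circle of values of `r`
(`cfcₙ_resolventFun`). Since *-homomorphisms commute with the continuous functional calculus, `φ` is
determined by `φ r`, and `φ(f) = f(D)` for all `f` follows once left multiplication by `φ r` on
`A_φ` is the resolvent of `D`.

Existence: a bounded `R` with dense range satisfying `R - R* = -2i R R*` and commuting with `R*` is
the resolvent of a self-adjoint regular operator, namely `R⁻¹ - i`
(`IsResolventPair.adjointGraph_eq`, `IsResolventPair.isRegular`). Multiplication by `φ r` qualifies;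
its range is dense because `f = r · (d + i) f` for compactly supported `f`, and such `f` are dense.
Degree one comes from `r(-t) = -r*(t)`: the grading exchanges `R` with `-R*`, hence `D` with `-D`.
The map `y ↦ (R y, y - i R y)` parametrizes the graph of `D` continuously, which gives the core.

Maximality: a self-adjoint regular `D'` on `E` has a resolvent (`exists_isResolvent`), whose range
is dense in `E`. It equals `r(D')`, which is multiplication by `φ r`, so its range lies in `A_φ`,
which is closed. -/

/-- The function `g` on the circle `{(t + i)⁻¹} ∪ {0}` with `g((t + i)⁻¹) = f t` and `g 0 = 0`. -/
noncomputable def onResolventCircle (f : ℝ → ℂ) (z : ℂ) : ℂ :=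
  if z = 0 then 0 else f (z⁻¹ - Complex.I).re

/-- The circle `{(t + i)⁻¹ | t ∈ ℝ} ∪ {0}`. -/
def resolventCircle : Set ℂ := {z | z - star z = (-2 * Complex.I) * (z * star z)}

theorem ofReal_add_I_ne_zero (t : ℝ) : (t : ℂ) + Complex.I ≠ 0 := fun h => by
  simpa using congrArg Complex.im h

theorem ofReal_sub_I_ne_zero (t : ℝ) : (t : ℂ) - Complex.I ≠ 0 := fun h => by
  simpa using congrArg Complex.im h

/-- Dividing the equation of the circle by `z * star z` gives `Im z⁻¹ = 1`. -/
theorem inv_sub_I_eq_ofReal {z : ℂ} (hz : z ∈ resolventCircle) (h0 : z ≠ 0) :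
    z⁻¹ - Complex.I = ((z⁻¹ - Complex.I).re : ℂ) := by
  have hs : star z ≠ 0 := star_ne_zero.2 h0
  have h : z⁻¹ - star z⁻¹ = 2 * Complex.I := by
    have hz' : z - star z = (-2 * Complex.I) * (z * star z) := hz
    rw [star_inv₀]
    field_simp
    linear_combination -hz'
  apply Complex.ext
  · simp
  · have := congrArg Complex.im h
    rw [Complex.sub_im, Complex.star_def, Complex.conj_im] at this
    rw [Complex.sub_im, Complex.I_im, Complex.ofReal_im]
    have h2 : (2 * Complex.I).im = 2 := by simp
    linarith

theorem onResolventCircle_inv (f : ℝ → ℂ) (t : ℝ) :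
    onResolventCircle f ((t + Complex.I)⁻¹) = f t := by
  rw [onResolventCircle, if_neg (inv_ne_zero (ofReal_add_I_ne_zero t))]
  simp

theorem onResolventCircle_eq_self {z : ℂ} (hz : z ∈ resolventCircle) :
    onResolventCircle (fun t => (t + Complex.I)⁻¹) z = z := by
  by_cases h0 : z = 0
  · simp [onResolventCircle, h0]
  · rw [onResolventCircle, if_neg h0, ← inv_sub_I_eq_ofReal hz h0]
    simp

theorem exists_forall_norm_lt (f : C₀(ℝ, ℂ)) {ε : ℝ} (hε : 0 < ε) :
    ∃ N : ℝ, ∀ t : ℝ, N ≤ |t| → ‖f t‖ < ε := by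
  have hev : ∀ᶠ t in Filter.cocompact ℝ, ‖f t‖ < ε := by
    have h := (zero_at_infty f).norm
    rw [norm_zero] at h
    exact h.eventually_lt_const hε
  rw [← Metric.cobounded_eq_cocompact, ← comap_norm_atTop, Filter.eventually_comap,
    Filter.eventually_atTop] at hev
  obtain ⟨N, hN⟩ := hev
  exact ⟨N, fun t ht => hN _ ht t rfl⟩

theorem continuousOn_onResolventCircle (f : C₀(ℝ, ℂ)) :
    ContinuousOn (onResolventCircle f) resolventCircle := by
  intro z hz
  by_cases h0 : z = 0
  · subst h0
    rw [Metric.continuousWithinAt_iff]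
    intro ε hε
    obtain ⟨N, hN⟩ := exists_forall_norm_lt f hε
    -- If `‖w‖` is below this radius, then `‖w⁻¹‖ > max N 0 + 2`, and subtracting `i` costs at most
    -- `1`. On the circle `w⁻¹ - i` is real, so `f` is evaluated beyond `N`.
    refine ⟨(max N 0 + 2)⁻¹, by positivity, fun {w} hw hd => ?_⟩
    have hg0 : onResolventCircle f 0 = 0 := by simp [onResolventCircle]
    rw [hg0, dist_zero_right]
    rw [dist_zero_right] at hd
    by_cases hw0 : w = 0
    · simpa [onResolventCircle, hw0] using hε
    rw [onResolventCircle, if_neg hw0]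
    refine hN _ ?_
    have h1 : |(w⁻¹ - Complex.I).re| = ‖w⁻¹ - Complex.I‖ := by
      conv_rhs => rw [inv_sub_I_eq_ofReal hw hw0, Complex.norm_real, Real.norm_eq_abs]
    rw [h1]
    have h2 : max N 0 + 2 < ‖w⁻¹‖ := by
      rw [norm_inv]
      exact (lt_inv_comm₀ (norm_pos_iff.2 hw0) (by positivity)).1 hd
    have h3 := norm_sub_norm_le w⁻¹ Complex.I
    rw [Complex.norm_I] at h3
    linarith [le_max_left N 0]
  · apply ContinuousAt.continuousWithinAt
    have : (fun w : ℂ => f (w⁻¹ - Complex.I).re) =ᶠ[nhds z] onResolventCircle f := by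
      filter_upwards [isOpen_ne.mem_nhds h0] with w hw
      rw [onResolventCircle, if_neg hw]
    refine ContinuousAt.congr ?_ this
    have h1 : ContinuousAt (fun w : ℂ => (w⁻¹ - Complex.I).re) z :=
      Complex.continuous_re.continuousAt.comp ((continuousAt_inv₀ h0).sub continuousAt_const)
    exact (map_continuous f).continuousAt.comp (f := fun w : ℂ => (w⁻¹ - Complex.I).re) h1

/-- The circle is cut out by an equation in `z` and `star z`. Two continuous functions vanishing at
`0` have equal values at a normal element only if they agree on its quasispectrum. -/
theorem quasispectrum_subset_resolventCircle {B : Type*} [NonUnitalCStarAlgebra B] (a : B)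
    [IsStarNormal a] (h : a - star a = (-2 * Complex.I) • (a * star a)) :
    quasispectrum ℂ a ⊆ resolventCircle := by
  have h1 : cfcₙ (fun z : ℂ => z - star z) a
      = cfcₙ (fun z : ℂ => (-2 * Complex.I) * (z * star z)) a := by
    rw [cfcₙ_sub (fun z : ℂ => z) (fun z => star z) a,
      cfcₙ_const_mul (-2 * Complex.I) (fun z : ℂ => z * star z) a,
      cfcₙ_mul (fun z : ℂ => z) (fun z => star z) a, cfcₙ_id' ℂ a, cfcₙ_star_id a, h]
  exact (cfcₙ_eq_cfcₙ_iff_eqOn (R := ℂ) (a := a)).1 h1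

/-! ### The generator `(t + i)⁻¹` of `C₀(ℝ)` -/

/-- The function `t ↦ (t + i)⁻¹` in `C₀(ℝ)`. -/
noncomputable def resolventFun : C₀(ℝ, ℂ) where
  toFun t := (t + Complex.I)⁻¹
  continuous_toFun := by
    refine Continuous.inv₀ (by fun_prop) ofReal_add_I_ne_zero
  zero_at_infty' := by
    refine Filter.Tendsto.comp Filter.tendsto_inv₀_cobounded ?_
    rw [← Metric.cobounded_eq_cocompact, ← tendsto_norm_atTop_iff_cobounded]
    refine Filter.tendsto_atTop_mono (f := fun t : ℝ => ‖t‖ - 1) (fun t => ?_) ?_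
    · have := norm_sub_norm_le (t : ℂ) (-Complex.I)
      simpa using this
    · exact Filter.tendsto_atTop_add_const_right _ _ tendsto_norm_cobounded_atTop

@[simp] theorem resolventFun_apply (t : ℝ) : resolventFun t = ((t : ℂ) + Complex.I)⁻¹ := rfl

@[simp] theorem star_resolventFun_apply (t : ℝ) :
    (star resolventFun : C₀(ℝ, ℂ)) t = ((t : ℂ) - Complex.I)⁻¹ := by
  simp [ZeroAtInftyContinuousMap.star_apply, sub_eq_add_neg]

theorem resolventFun_sub_star :
    resolventFun - star resolventFun
      = (-2 * Complex.I) • (resolventFun * star resolventFun) := by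
  ext t
  have h1 := ofReal_add_I_ne_zero t
  have h2 := ofReal_sub_I_ne_zero t
  simp only [ZeroAtInftyContinuousMap.sub_apply, ZeroAtInftyContinuousMap.smul_apply,
    ZeroAtInftyContinuousMap.mul_apply, resolventFun_apply, star_resolventFun_apply, smul_eq_mul]
  field_simp
  ring

/-- Evaluation at a point, as a *-homomorphism on `C₀(ℝ)`. -/
noncomputable def evalStarHom (t : ℝ) : C₀(ℝ, ℂ) →⋆ₙₐ[ℂ] ℂ where
  toFun f := f t
  map_smul' _ _ := rfl
  map_zero' := rfl
  map_add' _ _ := rfl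
  map_mul' _ _ := rfl
  map_star' _ := rfl

instance : IsStarNormal resolventFun := ⟨mul_comm _ _⟩

-- Point evaluations are *-homomorphisms separating `C₀(ℝ)`, and they commute with the functional
-- calculus. This leaves the scalar identity `g((t + i)⁻¹) = f t`.
open scoped CStarAlgebra in
theorem cfcₙ_resolventFun (f : C₀(ℝ, ℂ)) : cfcₙ (onResolventCircle f) resolventFun = f := by
  have hsub := quasispectrum_subset_resolventCircle _ resolventFun_sub_star
  ext t
  have h := (evalStarHom t).map_cfcₙ (onResolventCircle f) resolventFun
    ((continuousOn_onResolventCircle f).mono hsub) (by simp [onResolventCircle])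
    (map_continuous (evalStarHom t)) inferInstance
    (show IsStarNormal (evalStarHom t resolventFun) from ⟨mul_comm _ _⟩)
  change evalStarHom t _ = _
  have hr : evalStarHom t resolventFun = algebraMap ℂ ℂ ((t + Complex.I)⁻¹) := rfl
  rw [h, hr]
  rw [cfcₙ_eq_cfc (hf := ?_) (hf0 := by simp [onResolventCircle])]
  · rw [cfc_algebraMap, onResolventCircle_inv]
    rfl
  · have : IsStarNormal (algebraMap ℂ ℂ ((t + Complex.I)⁻¹)) := ⟨mul_comm _ _⟩
    exact (continuousOn_onResolventCircle f).mono (quasispectrum_subset_resolventCircle _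
      (congrArg (evalStarHom t) resolventFun_sub_star))

open scoped CStarAlgebra in
theorem cfcₙ_map_resolventFun {B : Type*} [NonUnitalCStarAlgebra B] (π : C₀(ℝ, ℂ) →⋆ₙₐ[ℂ] B)
    (f : C₀(ℝ, ℂ)) : cfcₙ (onResolventCircle f) (π resolventFun) = π f := by
  have hsub := quasispectrum_subset_resolventCircle _ resolventFun_sub_star
  have hn : IsStarNormal (π resolventFun) := IsStarNormal.map π resolventFun
  have h := π.map_cfcₙ (onResolventCircle f) resolventFun
    ((continuousOn_onResolventCircle f).mono hsub) (by simp [onResolventCircle])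
    (map_continuous π) inferInstance hn
  rw [← h, cfcₙ_resolventFun]

/-! ### Compactly supported functions are dense in `C₀(ℝ)` -/

theorem dense_hasCompactSupport : Dense {f : C₀(ℝ, ℂ) | HasCompactSupport f} := by
  intro f
  rw [Metric.mem_closure_iff]
  intro ε hε
  obtain ⟨N, hN⟩ := exists_forall_norm_lt f (half_pos hε)
  -- A cutoff equal to `1` for `|t| < N` and to `0` for `|t| > N + 1`, linear in between. The error
  -- `(1 - χ) f` lives where `f` is already small.
  let χ : ℝ → ℝ := fun t => max 0 (1 - max 0 (|t| - N))
  have hχc : Continuous χ := by fun_prop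
  have hχ0 : ∀ t, 0 ≤ χ t := fun t => le_max_left _ _
  have hχ1 : ∀ t, χ t ≤ 1 := fun t => max_le zero_le_one (by linarith [le_max_left 0 (|t| - N)])
  have hχN : ∀ t, |t| < N → χ t = 1 := fun t ht => by
    simp only [χ]
    rw [max_eq_left (by linarith : |t| - N ≤ 0)]
    simp
  have hcs : HasCompactSupport (fun t => (χ t : ℂ) * f t) := by
    refine HasCompactSupport.intro (isCompact_closedBall (0 : ℝ) (N + 1)) fun t ht => ?_
    rw [Metric.mem_closedBall, dist_zero_right, Real.norm_eq_abs, not_le] at ht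
    have : χ t = 0 := max_eq_left (by linarith [le_max_right 0 (|t| - N)])
    simp [this]
  have hc : Continuous (fun t => (χ t : ℂ) * f t) :=
    (Complex.continuous_ofReal.comp hχc).mul (map_continuous f)
  refine ⟨⟨⟨_, hc⟩, hcs.is_zero_at_infty⟩, hcs, ?_⟩
  rw [← ZeroAtInftyContinuousMap.dist_toBCF_eq_dist]
  refine lt_of_le_of_lt ((BoundedContinuousFunction.dist_le (half_pos hε).le).2 fun t => ?_)
    (half_lt_self hε)
  change dist (f t) ((χ t : ℂ) * f t) ≤ ε / 2
  by_cases ht : |t| < N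
  · rw [hχN t ht]
    simpa using (half_pos hε).le
  · have h1 := (hN t (not_lt.1 ht)).le
    have h2 : f t - χ t * f t = ((1 - χ t : ℝ) : ℂ) * f t := by push_cast; ring
    rw [dist_eq_norm, h2, norm_mul, Complex.norm_real, Real.norm_eq_abs,
      abs_of_nonneg (by linarith [hχ1 t])]
    nlinarith [hχ0 t, norm_nonneg (f t)]

namespace HilbertSubmodule

variable {A : Type*} [NonUnitalCStarAlgebra A] {E : HilbertSubmodule A}

/-! ### Rules for the inner product and the right action -/

theorem incl_injective : Function.Injective E.incl := E.incl.injective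

@[simp] theorem incl_rmul (x : E.Elem) (a : A) : E.incl (E.rmul x a) = E.incl x * a := rfl

theorem ip_add_right (x y z : E.Elem) : E.ip x (y + z) = E.ip x y + E.ip x z := by
  simp [ip, mul_add]

theorem ip_add_left (x y z : E.Elem) : E.ip (x + y) z = E.ip x z + E.ip y z := by
  simp [ip, add_mul]

theorem ip_sub_left (x y z : E.Elem) : E.ip (x - y) z = E.ip x z - E.ip y z := by
  simp [ip, sub_mul]

theorem ip_smul_right (c : ℂ) (x y : E.Elem) : E.ip x (c • y) = c • E.ip x y := by
  simp [ip, mul_smul_comm]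

theorem ip_smul_left (c : ℂ) (x y : E.Elem) : E.ip (c • x) y = star c • E.ip x y := by
  simp [ip, smul_mul_assoc]

theorem continuous_ip_left (y : E.Elem) : Continuous fun x => E.ip x y :=
  E.incl.continuous.star.mul continuous_const

theorem IsAdj.map_rmul {T S : E.Elem →L[ℂ] E.Elem} (h : E.IsAdj T S) (x : E.Elem) (a : A) :
    T (E.rmul x a) = E.rmul (T x) a := by
  refine E.ext_ip fun y => ?_
  rw [← h.symm, ip, incl_rmul, ip, incl_rmul, ← mul_assoc, ← mul_assoc]
  exact congrArg (· * a) (h.symm y x)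

theorem rmul_add (x y : E.Elem) (a : A) : E.rmul (x + y) a = E.rmul x a + E.rmul y a :=
  incl_injective (by simp [add_mul])

theorem rmul_smul (c : ℂ) (x : E.Elem) (a : A) : E.rmul (c • x) a = c • E.rmul x a :=
  incl_injective (by simp [smul_mul_assoc])

theorem exists_apply_eq_of_mem_graph {D : E.Elem →ₗ.[ℂ] E.Elem} {p : E.Elem × E.Elem}
    (hp : p ∈ D.graph) : ∃ hd : p.1 ∈ D.domain, D ⟨p.1, hd⟩ = p.2 := by
  obtain ⟨y, h1, h2⟩ := (LinearPMap.mem_graph_iff _).1 hp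
  refine ⟨h1 ▸ y.2, ?_⟩
  rw [← h2]
  congr 1
  exact Subtype.ext h1.symm

/-! ### Self-adjoint regular operators with a given resolvent -/

/-- `R` has dense range, and `R` and its adjoint satisfy the resolvent identity of `(t + i)⁻¹`
and `(t - i)⁻¹`. -/
structure IsResolventPair (E : HilbertSubmodule A) (R S : E.Elem →L[ℂ] E.Elem) : Prop where
  adj : E.IsAdj R S
  comm : ∀ x, R (S x) = S (R x)
  sub_eq : ∀ x, S x = R x + (2 * Complex.I) • R (S x)
  dense : DenseRange R

/-- The graph of `R⁻¹ - i`. -/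
def graphOfResolvent (R : E.Elem →L[ℂ] E.Elem) : Submodule ℂ (E.Elem × E.Elem) where
  carrier := {p | R (p.2 + Complex.I • p.1) = p.1}
  add_mem' := by
    intro p q hp hq
    have hp' : R (p.2 + Complex.I • p.1) = p.1 := hp
    have hq' : R (q.2 + Complex.I • q.1) = q.1 := hq
    change R (p.2 + q.2 + Complex.I • (p.1 + q.1)) = p.1 + q.1
    conv_rhs => rw [← hp', ← hq', ← map_add]
    congr 1
    module
  zero_mem' := by simp
  smul_mem' := by
    intro c p hp
    have hp' : R (p.2 + Complex.I • p.1) = p.1 := hp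
    change R (c • p.2 + Complex.I • (c • p.1)) = c • p.1
    conv_rhs => rw [← hp', ← map_smul]
    congr 1
    module

theorem mem_graphOfResolvent {R : E.Elem →L[ℂ] E.Elem} {p : E.Elem × E.Elem} :
    p ∈ graphOfResolvent R ↔ R (p.2 + Complex.I • p.1) = p.1 := Iff.rfl

/-- The operator `R⁻¹ - i`. -/
noncomputable def ofResolvent (R : E.Elem →L[ℂ] E.Elem) : E.Elem →ₗ.[ℂ] E.Elem :=
  (graphOfResolvent R).toLinearPMap

namespace IsResolventPair

variable {R S : E.Elem →L[ℂ] E.Elem} (h : E.IsResolventPair R S)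
include h

theorem sub_eq' (x : E.Elem) : R x = S x - (2 * Complex.I) • S (R x) := by
  rw [h.sub_eq x, h.comm]
  module

/-- The resolvent identity and commutation give `ker R ⊆ ker S`. A vector killed by `S = R*` is
orthogonal to the dense range of `R`, hence zero. -/
theorem injective : Function.Injective R := by
  rw [injective_iff_map_eq_zero]
  intro x hx
  have hS : S x = 0 := by
    rw [h.sub_eq, h.comm, hx]
    simp
  have h0 : (fun z => E.ip z x) = fun _ => 0 := by
    refine h.dense.equalizer (continuous_ip_left x) continuous_const ?_
    funext y
    change E.ip (R y) x = 0
    rw [h.adj, hS]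
    simp [ip]
  have h1 := E.ip_self_norm x
  rw [congrFun h0 x, norm_zero, eq_comm, mul_self_eq_zero, norm_eq_zero] at h1
  exact h1

theorem graph_eq : (ofResolvent R).graph = graphOfResolvent R := by
  refine Submodule.toLinearPMap_graph_eq _ fun p hp h0 => ?_
  rw [mem_graphOfResolvent, h0, smul_zero, add_zero] at hp
  exact (injective_iff_map_eq_zero R).1 h.injective _ hp

theorem mem_graph_iff {p : E.Elem × E.Elem} :
    p ∈ (ofResolvent R).graph ↔ R (p.2 + Complex.I • p.1) = p.1 := by
  rw [h.graph_eq, mem_graphOfResolvent]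

/-- This says `R⁻¹ - i = S⁻¹ + i`, the resolvent identity read as a statement about graphs. -/
theorem mem_graph_iff_adj {p : E.Elem × E.Elem} :
    p ∈ (ofResolvent R).graph ↔ S (p.2 - Complex.I • p.1) = p.1 := by
  rw [h.mem_graph_iff]
  symm
  constructor
  · intro hp
    have h1 : p.2 + Complex.I • p.1
        = (p.2 - Complex.I • p.1) + (2 * Complex.I) • S (p.2 - Complex.I • p.1) := by
      rw [hp]; module
    rw [h1, map_add, map_smul, ← h.sub_eq, hp]
  · intro hp
    have h1 : p.2 - Complex.I • p.1
        = (p.2 + Complex.I • p.1) - (2 * Complex.I) • R (p.2 + Complex.I • p.1) := by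
      rw [hp]; module
    rw [h1, map_sub, map_smul, ← h.sub_eq', hp]

theorem mem_graph (y : E.Elem) : (R y, y - Complex.I • R y) ∈ (ofResolvent R).graph := by
  rw [h.mem_graph_iff]
  simp

theorem isResolvent (T : E.L) (hT : T.1 = R) : E.IsResolvent (ofResolvent R) T := by
  constructor
  · intro x
    rw [hT]
    obtain ⟨hd, he⟩ := exists_apply_eq_of_mem_graph (h.mem_graph x)
    exact ⟨hd, by rw [he]; simp⟩
  · intro y
    rw [hT]
    exact h.mem_graph_iff.1 ((ofResolvent R).mem_graph y)

/-- The graph consists of the pairs `(R y, y - i R y)`. Testing `p` against them and moving `R`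
across as `S` turns the adjoint condition into `S (p.2 - i p.1) = p.1`, which is the description of
the graph through `S`. -/
theorem adjointGraph_eq : E.adjointGraph (ofResolvent R) = (ofResolvent R).graph := by
  have key : ∀ p : E.Elem × E.Elem,
      p ∈ E.adjointGraph (ofResolvent R) ↔ S (p.2 - Complex.I • p.1) = p.1 := by
    intro p
    have h1 : p ∈ E.adjointGraph (ofResolvent R) ↔
        ∀ y : E.Elem, E.ip (y - Complex.I • R y) p.1 = E.ip (R y) p.2 := by
      constructor
      · intro hp y
        obtain ⟨hd, he⟩ := exists_apply_eq_of_mem_graph (h.mem_graph y)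
        have := hp ⟨R y, hd⟩
        rwa [he] at this
      · intro hp x
        have hx := h.mem_graph_iff.1 ((ofResolvent R).mem_graph x)
        have := hp (ofResolvent R x + Complex.I • (x : E.Elem))
        rw [hx] at this
        simpa using this
    have h2 : ∀ y : E.Elem, E.ip (y - Complex.I • R y) p.1
        = E.ip y (p.1 + Complex.I • S p.1) := by
      intro y
      rw [ip_sub_left, ip_smul_left, h.adj, ip_add_right, ip_smul_right]
      simp
    rw [h1]
    simp only [h2, h.adj _ p.2]
    constructor
    · intro hp
      have := E.ext_ip hp
      rw [map_sub, map_smul, ← this]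
      simp
    · intro hp y
      congr 1
      nth_rewrite 1 [← hp]
      rw [map_sub, map_smul]
      simp
  ext p
  rw [key, h.mem_graph_iff_adj]

theorem adj_eq : E.adj (ofResolvent R) = ofResolvent R := by
  refine LinearPMap.eq_of_eq_graph ?_
  rw [HilbertSubmodule.adj, h.adjointGraph_eq]
  refine Submodule.toLinearPMap_graph_eq _ fun p hp h0 => ?_
  exact LinearPMap.graph_fst_eq_zero_snd _ (x := p.1) (x' := p.2) hp h0

theorem dense_domain : Dense ((ofResolvent R).domain : Set E.Elem) := by
  refine h.dense.mono ?_
  rintro _ ⟨y, rfl⟩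
  exact (exists_apply_eq_of_mem_graph (h.mem_graph y)).1

theorem rmul_mem_graph {p : E.Elem × E.Elem} (hp : p ∈ (ofResolvent R).graph) (a : A) :
    (E.rmul p.1 a, E.rmul p.2 a) ∈ (ofResolvent R).graph := by
  rw [h.mem_graph_iff] at hp ⊢
  rw [← rmul_smul, ← rmul_add, h.adj.map_rmul, hp]

theorem isRegular : E.IsRegular (ofResolvent R) where
  dense_domain := h.dense_domain
  closed := by
    have : ((ofResolvent R).graph : Set (E.Elem × E.Elem))
        = {p | R (p.2 + Complex.I • p.1) = p.1} := Set.ext fun p => h.mem_graph_iff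
    rw [LinearPMap.IsClosed, this]
    exact isClosed_eq (by fun_prop) (by fun_prop)
  rmul_mem x a := (exists_apply_eq_of_mem_graph (h.rmul_mem_graph ((ofResolvent R).mem_graph x) a)).1
  map_rmul x a := (exists_apply_eq_of_mem_graph (h.rmul_mem_graph ((ofResolvent R).mem_graph x) a)).2
  dense_adj_domain := by
    rw [h.adj_eq]
    exact h.dense_domain
  dense_range := by
    rw [h.adj_eq]
    -- The range is all of `E`: the solution of `x + D² x = w` is `x = R S w`, with `D x = S w - i R
    -- S w` and `D² x = w - R S w`.
    refine dense_univ.mono fun w _ => ?_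
    have h1 : (R (S w), S w - Complex.I • R (S w)) ∈ (ofResolvent R).graph := h.mem_graph _
    have h2 : (S w - Complex.I • R (S w), w - R (S w)) ∈ (ofResolvent R).graph := by
      rw [h.mem_graph_iff]
      have : w - R (S w) + Complex.I • (S w - Complex.I • R (S w)) = w + Complex.I • S w := by
        rw [smul_sub, smul_smul, Complex.I_mul_I]
        module
      simp only [this]
      rw [map_add, map_smul]
      linear_combination (norm := module) (-1 : ℂ) • h.sub_eq w
    obtain ⟨hd1, he1⟩ := exists_apply_eq_of_mem_graph h1
    obtain ⟨hd2, he2⟩ := exists_apply_eq_of_mem_graph h2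
    simp only at he1 he2
    refine ⟨⟨_, hd1⟩, he1 ▸ hd2, ?_⟩
    simp only [he1, he2]
    module

end IsResolventPair

/-! ### Uniqueness and existence of resolvents -/

theorem IsResolvent.unique {D : E.Elem →ₗ.[ℂ] E.Elem} {R R' : E.L} (h : E.IsResolvent D R)
    (h' : E.IsResolvent D R') : R = R' := by
  refine Subtype.ext (ContinuousLinearMap.ext fun x => ?_)
  obtain ⟨hd, he⟩ := h.1 x
  have := h'.2 ⟨R.1 x, hd⟩
  rw [he] at this
  exact this.symm

theorem IsResolvent.resolvent_eq {D : E.Elem →ₗ.[ℂ] E.Elem} {R : E.L} (h : E.IsResolvent D R) :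
    E.resolvent D = R := by
  have hex : ∃ R : E.L, E.IsResolvent D R := ⟨R, h⟩
  rw [resolvent, dif_pos hex]
  exact hex.choose_spec.unique h

/-- The defining identity of a symmetric operator. -/
theorem ip_apply_of_selfAdjoint {D : E.Elem →ₗ.[ℂ] E.Elem} (hd : Dense (D.domain : Set E.Elem))
    (hD : E.adj D = D) (x y : D.domain) : E.ip (D x) y = E.ip (x : E.Elem) (D y) := by
  -- `adj` has the intended graph only if `adjointGraph` is single-valued; density of the domain
  -- ensures this.
  have hg : (E.adj D).graph = E.adjointGraph D := by
    refine Submodule.toLinearPMap_graph_eq _ fun p hp h0 => ?_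
    have h1 : (fun x => E.ip x p.2) = fun _ => 0 := by
      refine hd.denseRange_val.equalizer (continuous_ip_left p.2) continuous_const ?_
      funext z
      have := hp z
      rw [h0] at this
      simpa [ip] using this.symm
    have h2 := E.ip_self_norm p.2
    rw [congrFun h1 p.2, norm_zero, eq_comm, mul_self_eq_zero, norm_eq_zero] at h2
    exact h2
  have hm : ((y : E.Elem), D y) ∈ E.adjointGraph D := by
    rw [← hg, hD]
    exact D.mem_graph y
  exact hm x

/-- For `c = ±i` the cross terms cancel, so `⟨(D + c) x, (D + c) x⟩ = ⟨D x, D x⟩ + ⟨x, x⟩ ≥ ⟨x, x⟩`,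
and the norm is monotone on positive elements of `A`. -/
theorem norm_le_norm_apply_add_smul {D : E.Elem →ₗ.[ℂ] E.Elem}
    (hsym : ∀ x y : D.domain, E.ip (D x) y = E.ip (x : E.Elem) (D y)) (c : ℂ)
    (hc : c = Complex.I ∨ c = -Complex.I) (x : D.domain) :
    ‖(x : E.Elem)‖ ≤ ‖D x + c • (x : E.Elem)‖ := by
  let _ := CStarAlgebra.spectralOrder A
  have := CStarAlgebra.spectralOrderedRing A
  have h1 : E.ip (D x + c • (x : E.Elem)) (D x + c • (x : E.Elem))
      = E.ip (D x) (D x) + E.ip (x : E.Elem) x := by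
    rw [ip_add_left, ip_add_right, ip_add_right, ip_smul_left, ip_smul_left, ip_smul_right,
      ip_smul_right, hsym x x]
    rcases hc with rfl | rfl
    · simp only [smul_smul, Complex.star_def, Complex.conj_I, neg_mul, Complex.I_mul_I]
      module
    · simp only [smul_smul, Complex.star_def, map_neg, Complex.conj_I, neg_mul, mul_neg,
        Complex.I_mul_I]
      module
  have h2 : ‖E.ip (x : E.Elem) x‖
      ≤ ‖E.ip (D x + c • (x : E.Elem)) (D x + c • (x : E.Elem))‖ := by
    rw [h1]
    exact CStarAlgebra.norm_le_norm_of_nonneg_of_le (star_mul_self_nonneg _)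
      (le_add_of_nonneg_left (star_mul_self_nonneg _))
  rw [ip_self_norm, ip_self_norm] at h2
  exact (mul_self_le_mul_self_iff (norm_nonneg _) (norm_nonneg _)).2 h2

/-- On the complete space `D.graph` the map `D + c` is bounded and bounded below, so its range is
closed. Since `c² = -1`, `1 + D² = (D + c)(D - c)`, so the range is also dense by regularity. -/
theorem exists_apply_add_smul_eq {D : E.Elem →ₗ.[ℂ] E.Elem} (hreg : E.IsRegular D)
    (hD : E.adj D = D) (c : ℂ) (hc : c = Complex.I ∨ c = -Complex.I) (w : E.Elem) :
    ∃ x : D.domain, D x + c • (x : E.Elem) = w := by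
  have hsym := ip_apply_of_selfAdjoint hreg.dense_domain hD
  have hc2 : c * c = -1 := by rcases hc with rfl | rfl <;> simp
  have hc1 : ‖c‖ = 1 := by rcases hc with rfl | rfl <;> simp
  let T : D.graph →L[ℂ] E.Elem :=
    (ContinuousLinearMap.snd ℂ E.Elem E.Elem + c • ContinuousLinearMap.fst ℂ E.Elem E.Elem).comp
      D.graph.subtypeL
  have hT : ∀ p : D.graph, T p = p.1.2 + c • p.1.1 := fun _ => rfl
  have : CompleteSpace D.graph := hreg.closed.completeSpace_coe
  -- The graph carries the max norm; `‖x‖ ≤ ‖T p‖` and `‖D x‖ ≤ ‖T p‖ + ‖x‖` give the constant `2`.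
  have hanti : AntilipschitzWith 2 T := by
    refine AddMonoidHomClass.antilipschitz_of_bound T fun p => ?_
    obtain ⟨x, h1, h2⟩ := (LinearPMap.mem_graph_iff _).1 p.2
    have h3 := norm_le_norm_apply_add_smul hsym c hc x
    rw [h1, h2, ← hT] at h3
    have h4 : ‖p.1.2‖ ≤ ‖T p‖ + ‖p.1.1‖ := by
      have h5 : p.1.2 = T p - c • p.1.1 := by rw [hT]; module
      calc ‖p.1.2‖ = ‖T p - c • p.1.1‖ := congrArg _ h5
        _ ≤ ‖T p‖ + ‖c • p.1.1‖ := norm_sub_le _ _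
        _ = _ := by rw [norm_smul, hc1, one_mul]
    have h5 := norm_nonneg (T p)
    change max ‖p.1.1‖ ‖p.1.2‖ ≤ 2 * ‖T p‖
    exact max_le (by linarith) (by linarith)
  have hclosed : IsClosed (Set.range T) := hanti.isClosed_range T.uniformContinuous
  have hdense : DenseRange T := by
    refine hreg.dense_range.mono ?_
    rintro _ ⟨x, h1, rfl⟩
    have hadj : ∀ h' : D x ∈ (E.adj D).domain, ∃ h1 : D x ∈ D.domain,
        E.adj D ⟨D x, h'⟩ = D ⟨D x, h1⟩ := by
      rw [hD]
      exact fun h' => ⟨h', rfl⟩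
    obtain ⟨h1, hD2⟩ := hadj h1
    have h2 : (D x - c • (x : E.Elem), D ⟨D x, h1⟩ - c • D x) ∈ D.graph := by
      have := sub_mem (D.mem_graph ⟨D x, h1⟩) (D.graph.smul_mem c (D.mem_graph x))
      exact this
    refine ⟨⟨_, h2⟩, ?_⟩
    rw [hT]
    have h3 : D ⟨D x, h1⟩ - c • D x + c • (D x - c • (x : E.Elem)) = x + D ⟨D x, h1⟩ := by
      rw [smul_sub, smul_smul, hc2]
      module
    simp only [h3, hD2]
  have hw : w ∈ Set.range T := by
    rw [← hclosed.closure_eq, hdense.closure_range]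
    trivial
  obtain ⟨p, rfl⟩ := hw
  obtain ⟨x, h1, h2⟩ := (LinearPMap.mem_graph_iff _).1 p.2
  exact ⟨x, by rw [h1, h2, hT]⟩

theorem exists_inverse_add_smul {D : E.Elem →ₗ.[ℂ] E.Elem} (hreg : E.IsRegular D)
    (hD : E.adj D = D) (c : ℂ) (hc : c = Complex.I ∨ c = -Complex.I) :
    ∃ R : E.Elem →L[ℂ] E.Elem,
      (∀ x : E.Elem, ∃ h : R x ∈ D.domain, D ⟨R x, h⟩ + c • R x = x) ∧
      ∀ y : D.domain, R (D y + c • (y : E.Elem)) = y := by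
  have hbound := norm_le_norm_apply_add_smul (ip_apply_of_selfAdjoint hreg.dense_domain hD) c hc
  let T : D.domain →ₗ[ℂ] E.Elem := D.toFun + c • D.domain.subtype
  have hT : ∀ x : D.domain, T x = D x + c • (x : E.Elem) := fun _ => rfl
  have hinj : Function.Injective T := by
    rw [injective_iff_map_eq_zero]
    intro x hx
    have := hbound x
    rw [← hT, hx, norm_zero] at this
    exact Subtype.ext (norm_le_zero_iff.1 this)
  let e := LinearEquiv.ofBijective T ⟨hinj, exists_apply_add_smul_eq hreg hD c hc⟩
  have he : ∀ x, D (e.symm x) + c • (e.symm x : E.Elem) = x := fun x => e.apply_symm_apply x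
  let R : E.Elem →L[ℂ] E.Elem := (D.domain.subtype ∘ₗ e.symm.toLinearMap).mkContinuous 1
    fun x => by
      have := hbound (e.symm x)
      rw [he] at this
      simpa using this
  have hR : ∀ x, R x = e.symm x := fun _ => rfl
  refine ⟨R, fun x => ⟨(e.symm x).2, he x⟩, fun y => ?_⟩
  rw [hR]
  exact congrArg Subtype.val (e.symm_apply_apply y)

/-- A self-adjoint regular operator has a resolvent, which forms a resolvent pair with its
adjoint. -/
theorem exists_isResolvent {D : E.Elem →ₗ.[ℂ] E.Elem} (hreg : E.IsRegular D)
    (hD : E.adj D = D) :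
    ∃ R : E.L, E.IsResolvent D R ∧ E.IsResolventPair R.1 (star R).1 := by
  have hsym := ip_apply_of_selfAdjoint hreg.dense_domain hD
  obtain ⟨R, hR1, hR2⟩ := exists_inverse_add_smul hreg hD Complex.I (Or.inl rfl)
  obtain ⟨S, hS1, hS2⟩ := exists_inverse_add_smul hreg hD (-Complex.I) (Or.inr rfl)
  have hadj : E.IsAdj R S := by
    intro x y
    obtain ⟨hdx, hx⟩ := hR1 x
    obtain ⟨hdy, hy⟩ := hS1 y
    conv_lhs => rw [← hy]
    conv_rhs => rw [← hx]
    rw [ip_add_right, ip_add_left, ip_smul_right, ip_smul_left, hsym ⟨R x, hdx⟩ ⟨S y, hdy⟩]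
    simp
  -- Apply `R = (D + i)⁻¹` to `(D + i) S x = x + 2i S x`.
  have h1 : ∀ x, S x = R x + (2 * Complex.I) • R (S x) := by
    intro x
    obtain ⟨hd, hx⟩ := hS1 x
    have h2 := hR2 ⟨S x, hd⟩
    have h3 : D ⟨S x, hd⟩ + Complex.I • S x = x + (2 * Complex.I) • S x := by
      linear_combination (norm := module) hx
    rw [h3, map_add, map_smul] at h2
    exact h2.symm
  have h2 : ∀ x, R x = S x - (2 * Complex.I) • S (R x) := by
    intro x
    obtain ⟨hd, hx⟩ := hR1 x
    have h2 := hS2 ⟨R x, hd⟩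
    have h3 : D ⟨R x, hd⟩ + (-Complex.I) • R x = x - (2 * Complex.I) • R x := by
      linear_combination (norm := module) hx
    rw [h3, map_sub, map_smul] at h2
    exact h2.symm
  -- The two forms of the resolvent identity express `S x - R x` as `2i R S x` and as `2i S R x`.
  have hcomm : ∀ x, R (S x) = S (R x) := by
    intro x
    have h3 : (2 * Complex.I) • R (S x) = (2 * Complex.I) • S (R x) := by
      linear_combination (norm := module) (-1 : ℂ) • h1 x - h2 x
    exact smul_right_injective _ (by simp : (2 * Complex.I) ≠ 0) h3
  have hstar : star (⟨R, S, hadj⟩ : E.L) = ⟨S, R, hadj.symm⟩ := E.star_eq hadj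
  refine ⟨⟨R, S, hadj⟩, ⟨hR1, hR2⟩, ?_⟩
  rw [hstar]
  refine ⟨hadj, hcomm, h1, hreg.dense_domain.mono fun y hy => ?_⟩
  exact ⟨_, hR2 ⟨y, hy⟩⟩

/-! ### Functional calculus of the resolvent, and maximality -/

theorem IsResolventPair.sub_star_eq {R : E.L} (h : E.IsResolventPair R.1 (star R).1) :
    R - star R = (-2 * Complex.I) • (R * star R) := by
  refine Subtype.ext (ContinuousLinearMap.ext fun x => ?_)
  change R.1 x - (star R).1 x = (-2 * Complex.I) • R.1 ((star R).1 x)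
  linear_combination (norm := module) (-1 : ℂ) • h.sub_eq x

theorem IsResolventPair.isStarNormal {R : E.L} (h : E.IsResolventPair R.1 (star R).1) :
    IsStarNormal R :=
  ⟨Subtype.ext (ContinuousLinearMap.ext fun x => (h.comm x).symm)⟩

theorem funCalc_eq_cfcₙ (D : E.Elem →ₗ.[ℂ] E.Elem) (f : C₀(ℝ, ℂ)) :
    E.funCalc D f = cfcₙ (onResolventCircle f) (E.resolvent D) := rfl

theorem IsResolventPair.funCalc_resolventFun {R : E.L}
    (h : E.IsResolventPair R.1 (star R).1) {D : E.Elem →ₗ.[ℂ] E.Elem}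
    (hR : E.IsResolvent D R) : E.funCalc D resolventFun = R := by
  have := h.isStarNormal
  rw [funCalc_eq_cfcₙ, hR.resolvent_eq]
  conv_rhs => rw [← cfcₙ_id' ℂ R]
  exact cfcₙ_congr fun z hz => onResolventCircle_eq_self
    (quasispectrum_subset_resolventCircle R h.sub_star_eq hz)

theorem mul_mem_ofHom (φ : C₀(ℝ, ℂ) →⋆ₙₐ[ℂ] A) (f : C₀(ℝ, ℂ)) (a : A) :
    φ f * a ∈ (ofHom φ).toSubmodule :=
  Submodule.le_topologicalClosure _ (Submodule.subset_span ⟨f, a, rfl⟩)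

/-- Only `f = resolventFun` is needed: `R z = φ(r) z` lies in `A_φ`, and such vectors are dense in
`E`. -/
theorem Generates.le_ofHom {α : A ≃⋆ₐ[ℂ] A} {φ : C₀(ℝ, ℂ) →⋆ₙₐ[ℂ] A}
    {D : E.Elem →ₗ.[ℂ] E.Elem} (hD : E.Generates α φ D) :
    E.toSubmodule ≤ (ofHom φ).toSubmodule := by
  obtain ⟨R, hR, hpair⟩ := exists_isResolvent hD.regular hD.selfAdjoint
  intro x hx
  have hcl : IsClosed {y : E.Elem | E.incl y ∈ (ofHom φ).toSubmodule} :=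
    (ofHom φ).isClosed'.preimage E.incl.continuous
  have huniv : ∀ y : E.Elem, E.incl y ∈ (ofHom φ).toSubmodule := by
    intro y
    refine hcl.closure_subset_iff.2 ?_ (hpair.dense y)
    rintro _ ⟨z, rfl⟩
    have := hD.funCalc_eq resolventFun z
    rw [hpair.funCalc_resolventFun hR] at this
    change E.incl (R.1 z) ∈ (ofHom φ).toSubmodule
    rw [← this]
    exact mul_mem_ofHom φ _ _
  exact huniv (⟨x, hx⟩ : E.toSubmodule)

end HilbertSubmodule

/-! ### Gradings -/

theorem hasDegree_half_add {A : Type*} [NonUnitalCStarAlgebra A] {α : A ≃⋆ₐ[ℂ] A}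
    (hα : ∀ a : A, α (α a) = a) (x : A) : HasDegree α 0 ((2⁻¹ : ℂ) • (x + α x)) := by
  rw [HasDegree, map_smul, map_add, hα, pow_zero, one_smul, add_comm]

theorem hasDegree_half_sub {A : Type*} [NonUnitalCStarAlgebra A] {α : A ≃⋆ₐ[ℂ] A}
    (hα : ∀ a : A, α (α a) = a) (x : A) : HasDegree α 1 ((2⁻¹ : ℂ) • (x - α x)) := by
  rw [HasDegree, map_smul, map_sub, hα, pow_one]
  module

/-- The reflection `t ↦ f (-t)` of a function in `C₀(ℝ)`. -/
noncomputable def reflect (f : C₀(ℝ, ℂ)) : C₀(ℝ, ℂ) where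
  toFun t := f (-t)
  continuous_toFun := (map_continuous f).comp continuous_neg
  zero_at_infty' := (zero_at_infty f).comp (Homeomorph.neg ℝ).isClosedEmbedding.tendsto_cocompact

@[simp] theorem reflect_apply (f : C₀(ℝ, ℂ)) (t : ℝ) : reflect f t = f (-t) := rfl

/-- Split `f` into its even and odd parts: `α` fixes the image of the first and negates that of the
second. -/
theorem IsGradedHom.map_reflect {A : Type*} [NonUnitalCStarAlgebra A] {α : A ≃⋆ₐ[ℂ] A}
    {φ : C₀(ℝ, ℂ) →⋆ₙₐ[ℂ] A} (hφ : IsGradedHom α φ) (f : C₀(ℝ, ℂ)) :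
    α (φ f) = φ (reflect f) := by
  have h0 : HasDegree α 0 (φ ((2⁻¹ : ℂ) • (f + reflect f))) := hφ 0 _ fun t => by
    simp [add_comm]
  have h1 : HasDegree α 1 (φ ((2⁻¹ : ℂ) • (f - reflect f))) := hφ 1 _ fun t => by
    simp
    ring
  rw [HasDegree, pow_zero, one_smul] at h0
  rw [HasDegree, pow_one, neg_one_smul] at h1
  have h : f = (2⁻¹ : ℂ) • (f + reflect f) + (2⁻¹ : ℂ) • (f - reflect f) := by module
  conv_lhs => rw [h, map_add, map_add, h0, h1, ← map_neg, ← map_add]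
  congr 1
  module

theorem reflect_resolventFun : reflect resolventFun = -star resolventFun := by
  ext t
  simp only [reflect_apply, resolventFun_apply, ZeroAtInftyContinuousMap.neg_apply,
    star_resolventFun_apply, ← inv_neg]
  push_cast
  ring

/-! ### Multiplication by the coordinate -/

/-- The function `t ↦ t * f t` for compactly supported `f`. -/
noncomputable def coordMul (f : C₀(ℝ, ℂ)) (hf : HasCompactSupport f) : C₀(ℝ, ℂ) where
  toFun t := t * f t
  continuous_toFun := Complex.continuous_ofReal.mul (map_continuous f)
  zero_at_infty' := (hf.mul_left (f := fun t : ℝ => (t : ℂ))).is_zero_at_infty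

theorem resolventFun_mul_add {f df : C₀(ℝ, ℂ)} (h : ∀ t : ℝ, df t = t * f t) :
    resolventFun * (df + Complex.I • f) = f := by
  ext t
  have h1 := ofReal_add_I_ne_zero t
  simp only [ZeroAtInftyContinuousMap.mul_apply, ZeroAtInftyContinuousMap.add_apply,
    ZeroAtInftyContinuousMap.smul_apply, resolventFun_apply, h, smul_eq_mul]
  field_simp

theorem sub_I_smul_resolventFun_mul_apply (f : C₀(ℝ, ℂ)) (t : ℝ) :
    (f - Complex.I • (resolventFun * f)) t = t * (resolventFun * f) t := by
  have h1 := ofReal_add_I_ne_zero t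
  simp only [ZeroAtInftyContinuousMap.mul_apply, ZeroAtInftyContinuousMap.sub_apply,
    ZeroAtInftyContinuousMap.smul_apply, resolventFun_apply, smul_eq_mul]
  field_simp
  ring

namespace HilbertSubmodule

variable {A : Type*} [NonUnitalCStarAlgebra A] {α : A ≃⋆ₐ[ℂ] A} {φ : C₀(ℝ, ℂ) →⋆ₙₐ[ℂ] A}

/-! ### The module `A_φ` -/

theorem ofHom_le {V : Submodule ℂ A} (hV : IsClosed (V : Set A))
    (h : ∀ (f : C₀(ℝ, ℂ)) (a : A), φ f * a ∈ V) : (ofHom φ).toSubmodule ≤ V := by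
  refine Submodule.topologicalClosure_minimal _ (Submodule.span_le.2 ?_) hV
  rintro _ ⟨f, a, rfl⟩
  exact h f a

open scoped CStarAlgebra in
theorem ofHom_le_of_hasCompactSupport {V : Submodule ℂ A} (hV : IsClosed (V : Set A))
    (h : ∀ (f : C₀(ℝ, ℂ)) (a : A), HasCompactSupport f → φ f * a ∈ V) :
    (ofHom φ).toSubmodule ≤ V := by
  refine ofHom_le hV fun f a => ?_
  have hcl : IsClosed {f : C₀(ℝ, ℂ) | φ f * a ∈ V} :=
    hV.preimage ((map_continuous φ).mul continuous_const)
  exact hcl.closure_subset_iff.2 (fun f hf => h f a hf) (dense_hasCompactSupport f)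

theorem isInvariant_ofHom (φ : C₀(ℝ, ℂ) →⋆ₙₐ[ℂ] A) : (ofHom φ).IsInvariant φ := by
  intro f x
  refine ofHom_le (V := (ofHom φ).toSubmodule.comap (LinearMap.mulLeft ℂ (φ f)))
    ((ofHom φ).isClosed'.preimage (continuous_const_mul (φ f))) (fun g a => ?_)
    ((ofHom φ).incl_mem x)
  change φ f * (φ g * a) ∈ (ofHom φ).toSubmodule
  rw [← mul_assoc, ← map_mul]
  exact mul_mem_ofHom φ _ _

open scoped CStarAlgebra in
theorem map_mem_ofHom (hφ : IsGradedHom α φ) {x : A} (hx : x ∈ (ofHom φ).toSubmodule) :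
    α x ∈ (ofHom φ).toSubmodule := by
  have hc : Continuous α := map_continuous α
  refine ofHom_le (V := (ofHom φ).toSubmodule.comap (α : A →ₗ[ℂ] A))
    ((ofHom φ).isClosed'.preimage hc) (fun g a => ?_) hx
  change α (φ g * a) ∈ (ofHom φ).toSubmodule
  rw [map_mul, hφ.map_reflect]
  exact mul_mem_ofHom φ _ _

/-- The grading automorphism on `A_φ`. -/
noncomputable def gradingOfHom (hφ : IsGradedHom α φ) (x : (ofHom φ).Elem) : (ofHom φ).Elem :=
  (⟨α ((ofHom φ).incl x), map_mem_ofHom hφ ((ofHom φ).incl_mem x)⟩ : (ofHom φ).toSubmodule)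

@[simp] theorem incl_gradingOfHom (hφ : IsGradedHom α φ) (x : (ofHom φ).Elem) :
    (ofHom φ).incl (gradingOfHom hφ x) = α ((ofHom φ).incl x) := rfl

theorem isGraded_ofHom (hα : ∀ a : A, α (α a) = a) (hφ : IsGradedHom α φ) :
    (ofHom φ).IsGraded α := by
  intro x
  refine ⟨(2⁻¹ : ℂ) • (x + gradingOfHom hφ x), (2⁻¹ : ℂ) • (x - gradingOfHom hφ x), ?_, ?_, ?_⟩
  · rw [map_smul, map_add, incl_gradingOfHom]
    exact hasDegree_half_add hα _
  · rw [map_smul, map_sub, incl_gradingOfHom]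
    exact hasDegree_half_sub hα _
  · module

/-- Left multiplication by `φ f` on `A_φ`. -/
noncomputable def leftMul (φ : C₀(ℝ, ℂ) →⋆ₙₐ[ℂ] A) (f : C₀(ℝ, ℂ)) :
    (ofHom φ).Elem →L[ℂ] (ofHom φ).Elem :=
  LinearMap.mkContinuous
    { toFun := fun x => (⟨φ f * (ofHom φ).incl x, isInvariant_ofHom φ f x⟩ : (ofHom φ).toSubmodule)
      map_add' := fun x y => incl_injective (mul_add (φ f) ((ofHom φ).incl x) ((ofHom φ).incl y))
      map_smul' := fun c x => incl_injective (mul_smul_comm c (φ f) ((ofHom φ).incl x)) }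
    ‖φ f‖ fun x => norm_mul_le (φ f) ((ofHom φ).incl x)

@[simp] theorem incl_leftMul (f : C₀(ℝ, ℂ)) (x : (ofHom φ).Elem) :
    (ofHom φ).incl (leftMul φ f x) = φ f * (ofHom φ).incl x := rfl

theorem isAdj_leftMul (f : C₀(ℝ, ℂ)) :
    (ofHom φ).IsAdj (leftMul φ f) (leftMul φ (star f)) := fun x y => by
  simp [ip, map_star, mul_assoc]

/-- The representation of `C₀(ℝ)` on `A_φ` by left multiplication. -/
noncomputable def repr (φ : C₀(ℝ, ℂ) →⋆ₙₐ[ℂ] A) : C₀(ℝ, ℂ) →⋆ₙₐ[ℂ] (ofHom φ).L where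
  toFun f := ⟨leftMul φ f, _, isAdj_leftMul f⟩
  map_smul' c f := Subtype.ext (ContinuousLinearMap.ext fun x => incl_injective (by
    change φ (c • f) * _ = c • (φ f * _)
    rw [map_smul, smul_mul_assoc]))
  map_zero' := Subtype.ext (ContinuousLinearMap.ext fun x => incl_injective (by
    change φ 0 * _ = 0
    rw [map_zero, zero_mul]))
  map_add' f g := Subtype.ext (ContinuousLinearMap.ext fun x => incl_injective (by
    change φ (f + g) * _ = φ f * _ + φ g * _
    rw [map_add, add_mul]))
  map_mul' f g := Subtype.ext (ContinuousLinearMap.ext fun x => incl_injective (by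
    change φ (f * g) * _ = φ f * (φ g * _)
    rw [map_mul, mul_assoc]))
  map_star' f := ((ofHom φ).star_eq (isAdj_leftMul f)).symm

/-- For compactly supported `f`, `φ(f) a = φ(r) (φ((d + i) f) a)` is in the range, and these
products span a dense subspace of `A_φ`. -/
theorem denseRange_leftMul_resolventFun : DenseRange (leftMul φ resolventFun) := by
  intro x
  rw [(ofHom φ).incl.isometry.isEmbedding.isInducing.closure_eq_preimage_closure_image]
  have hle := ofHom_le_of_hasCompactSupport (φ := φ)
    (V := ((leftMul φ resolventFun).range.map (ofHom φ).incl.toLinearMap).topologicalClosure)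
    (Submodule.isClosed_topologicalClosure _) fun f a hf => by
      refine Submodule.le_topologicalClosure _ ?_
      refine ⟨_, ⟨(⟨_, mul_mem_ofHom φ (coordMul f hf + Complex.I • f) a⟩ :
        (ofHom φ).toSubmodule), rfl⟩, ?_⟩
      change φ resolventFun * (φ (coordMul f hf + Complex.I • f) * a) = φ f * a
      rw [← mul_assoc, ← map_mul, resolventFun_mul_add fun t => rfl]
  exact hle ((ofHom φ).incl_mem x)

theorem isResolventPair_leftMul (φ : C₀(ℝ, ℂ) →⋆ₙₐ[ℂ] A) :
    (ofHom φ).IsResolventPair (leftMul φ resolventFun) (leftMul φ (star resolventFun)) where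
  adj := isAdj_leftMul _
  comm x := incl_injective (by
    simp only [incl_leftMul, ← mul_assoc, ← map_mul]
    rw [mul_comm])
  sub_eq x := incl_injective (by
    have h := congrArg φ resolventFun_sub_star
    rw [map_sub, map_smul] at h
    simp only [incl_leftMul, map_add, map_smul, ← mul_assoc, ← map_mul, ← smul_mul_assoc,
      ← add_mul]
    congr 1
    linear_combination (norm := module) (-1 : ℂ) • h)
  dense := denseRange_leftMul_resolventFun

/-- The self-adjoint regular operator on `A_φ` with resolvent `φ ((t + i)⁻¹)`. -/
noncomputable def generator (φ : C₀(ℝ, ℂ) →⋆ₙₐ[ℂ] A) : (ofHom φ).Elem →ₗ.[ℂ] (ofHom φ).Elem :=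
  ofResolvent (leftMul φ resolventFun)

/-- Apply `α` to `R (D x + i x) = x`. As `α (φ r) = -φ(r*)`, the result is the graph condition
through `S` for `(α x, -α D x)`. -/
theorem gradingOfHom_mem_graph (hφ : IsGradedHom α φ) {p : (ofHom φ).Elem × (ofHom φ).Elem}
    (hp : p ∈ (generator φ).graph) :
    (gradingOfHom hφ p.1, -gradingOfHom hφ p.2) ∈ (generator φ).graph := by
  have h := isResolventPair_leftMul φ
  have hp' := congrArg (fun x => α ((ofHom φ).incl x)) (h.mem_graph_iff.1 hp)
  refine h.mem_graph_iff_adj.2 (incl_injective ?_)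
  simp only [incl_leftMul, map_mul, hφ.map_reflect, reflect_resolventFun, map_add, map_smul,
    map_neg] at hp'
  simp only [incl_leftMul, map_sub, map_neg, map_smul, incl_gradingOfHom]
  refine Eq.trans ?_ hp'
  rw [neg_mul, neg_mul]
  module

theorem isDegreeOne_generator (hα : ∀ a : A, α (α a) = a) (hφ : IsGradedHom α φ) :
    (ofHom φ).IsDegreeOne α (generator φ) := by
  constructor
  · intro x
    obtain ⟨hd, -⟩ := exists_apply_eq_of_mem_graph
      (gradingOfHom_mem_graph hφ ((generator φ).mem_graph x))
    refine ⟨(2⁻¹ : ℂ) • (x + ⟨_, hd⟩), (2⁻¹ : ℂ) • (x - ⟨_, hd⟩), ?_, ?_, ?_⟩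
    · exact hasDegree_half_add hα _
    · exact hasDegree_half_sub hα _
    · module
  · intro n x hx
    have h1 := gradingOfHom_mem_graph hφ ((generator φ).mem_graph x)
    have h2 := (generator φ).graph.smul_mem ((-1 : ℂ) ^ n) ((generator φ).mem_graph x)
    -- When `α x = (-1)ⁿ x`, both graph points have the same first coordinate, so `-α (D x) = (-1)ⁿ
    -- D x`.
    have h3 := (generator φ).mem_graph_snd_inj h1 h2 (incl_injective hx)
    have h4 := congrArg (ofHom φ).incl h3
    rw [map_neg, incl_gradingOfHom, neg_eq_iff_eq_neg] at h4
    rw [HasDegree, h4, map_smul, pow_succ]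
    module

theorem generates_generator (hα : ∀ a : A, α (α a) = a) (hφ : IsGradedHom α φ) :
    (ofHom φ).Generates α φ (generator φ) where
  regular := (isResolventPair_leftMul φ).isRegular
  selfAdjoint := (isResolventPair_leftMul φ).adj_eq
  degreeOne := isDegreeOne_generator hα hφ
  funCalc_eq f x := by
    have hR := (isResolventPair_leftMul φ).isResolvent (repr φ resolventFun) rfl
    rw [funCalc_eq_cfcₙ, generator, hR.resolvent_eq, cfcₙ_map_resolventFun]
    rfl

/-! ### The core of the generator -/

theorem exists_generator_iff {p : A × A} :
    (∃ x : (generator φ).domain,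
      p = ((ofHom φ).incl x, (ofHom φ).incl (generator φ x))) ↔
    p.1 ∈ (ofHom φ).toSubmodule ∧ p.2 ∈ (ofHom φ).toSubmodule ∧
      φ resolventFun * (p.2 + Complex.I • p.1) = p.1 := by
  have h := isResolventPair_leftMul φ
  constructor
  · rintro ⟨x, rfl⟩
    exact ⟨(ofHom φ).incl_mem _, (ofHom φ).incl_mem _,
      congrArg (ofHom φ).incl (h.mem_graph_iff.1 ((generator φ).mem_graph x))⟩
  · rintro ⟨h1, h2, h3⟩
    let u : (ofHom φ).Elem := (⟨p.1, h1⟩ : (ofHom φ).toSubmodule)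
    let v : (ofHom φ).Elem := (⟨p.2, h2⟩ : (ofHom φ).toSubmodule)
    have hg : (u, v) ∈ (generator φ).graph := h.mem_graph_iff.2 (incl_injective h3)
    obtain ⟨hd, he⟩ := exists_apply_eq_of_mem_graph hg
    exact ⟨⟨u, hd⟩, Prod.ext rfl (congrArg (ofHom φ).incl he.symm)⟩

theorem generator_graph_eq_closure (φ : C₀(ℝ, ℂ) →⋆ₙₐ[ℂ] A) :
    {p : A × A | ∃ x : (generator φ).domain,
      p = ((ofHom φ).incl x, (ofHom φ).incl (generator φ x))} =
    closure (coreGraph φ : Set (A × A)) := by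
  have hset := Set.ext fun p : A × A => exists_generator_iff (φ := φ) (p := p)
  refine Set.Subset.antisymm ?_ ?_
  · rintro p hp
    obtain ⟨h1, h2, h3⟩ := exists_generator_iff.1 hp
    -- `F y = (R y, D R y)` for `y` in `A_φ`, and each graph point `p` is `F (p.2 + i p.1)`. On
    -- `φ(f) a` with `f` compactly supported, `F` takes the value of the core pair of `r f`, so by
    -- continuity `F` maps `A_φ` into the closure of the core.
    let F : A →L[ℂ] A × A := (ContinuousLinearMap.mul ℂ A (φ resolventFun)).prod
      (ContinuousLinearMap.id ℂ A - Complex.I • ContinuousLinearMap.mul ℂ A (φ resolventFun))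
    have hF : ∀ y, F y = (φ resolventFun * y, y - Complex.I • (φ resolventFun * y)) :=
      fun _ => rfl
    have hle := ofHom_le_of_hasCompactSupport (φ := φ)
      (V := (coreGraph φ).topologicalClosure.comap F.toLinearMap)
      ((Submodule.isClosed_topologicalClosure _).preimage F.continuous) fun f a hf => by
        refine Submodule.le_topologicalClosure _ (Submodule.subset_span
          ⟨resolventFun * f, f - Complex.I • (resolventFun * f), a, hf.mul_left,
            sub_I_smul_resolventFun_mul_apply f, ?_⟩)
        change F (φ f * a) = _
        rw [hF, map_sub, map_smul, map_mul, sub_mul, smul_mul_assoc, mul_assoc]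
    have h4 : F (p.2 + Complex.I • p.1) ∈ (coreGraph φ).topologicalClosure :=
      hle (add_mem h2 (Submodule.smul_mem _ _ h1))
    rw [hF, h3, add_sub_cancel_right] at h4
    exact h4
  · refine closure_minimal ?_ ?_
    · have hle : coreGraph φ ≤ (generator φ).graph.map
          ((ofHom φ).incl.toLinearMap.prodMap (ofHom φ).incl.toLinearMap) := by
        refine Submodule.span_le.2 ?_
        rintro _ ⟨f, df, a, -, hdf, rfl⟩
        obtain ⟨x, hx⟩ := (exists_generator_iff (φ := φ) (p := (φ f * a, φ df * a))).2
          ⟨mul_mem_ofHom φ _ _, mul_mem_ofHom φ _ _, by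
            change φ resolventFun * (φ df * a + Complex.I • (φ f * a)) = φ f * a
            rw [← smul_mul_assoc, ← add_mul, ← map_smul, ← map_add, ← mul_assoc, ← map_mul,
              resolventFun_mul_add hdf]⟩
        exact ⟨_, (generator φ).mem_graph x, hx.symm⟩
      intro p hp
      obtain ⟨q, hq, rfl⟩ := hle hp
      obtain ⟨hd, he⟩ := exists_apply_eq_of_mem_graph hq
      exact ⟨⟨q.1, hd⟩, by rw [he]; rfl⟩
    · rw [hset]
      refine ((ofHom φ).isClosed'.preimage continuous_fst).inter
        (((ofHom φ).isClosed'.preimage continuous_snd).inter ?_)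
      exact isClosed_eq (by fun_prop) (by fun_prop)

end HilbertSubmodule

theorem proposition3p1 {A : Type*} [NonUnitalCStarAlgebra A]
    (α : A ≃⋆ₐ[ℂ] A) (hα : ∀ a : A, α (α a) = a)
    (φ : C₀(ℝ, ℂ) →⋆ₙₐ[ℂ] A) (hφ : IsGradedHom α φ) :
    (HilbertSubmodule.ofHom φ).IsGraded α ∧
    (HilbertSubmodule.ofHom φ).IsInvariant φ ∧
    (∃ D : (HilbertSubmodule.ofHom φ).Elem →ₗ.[ℂ] (HilbertSubmodule.ofHom φ).Elem,
      (HilbertSubmodule.ofHom φ).Generates α φ D ∧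
      {p : A × A | ∃ x : D.domain,
        p = ((HilbertSubmodule.ofHom φ).incl x, (HilbertSubmodule.ofHom φ).incl (D x))} =
        closure (coreGraph φ : Set (A × A))) ∧
    ∀ E : HilbertSubmodule A, E.IsGraded α → E.IsInvariant φ →
      (∃ D : E.Elem →ₗ.[ℂ] E.Elem, E.Generates α φ D) →
      E.toSubmodule ≤ (HilbertSubmodule.ofHom φ).toSubmodule :=
  ⟨HilbertSubmodule.isGraded_ofHom hα hφ, HilbertSubmodule.isInvariant_ofHom φ,
    ⟨HilbertSubmodule.generator φ, HilbertSubmodule.generates_generator hα hφ,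
      HilbertSubmodule.generator_graph_eq_closure φ⟩,
    fun _ _ _ ⟨_, hD⟩ => hD.le_ofHom⟩
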